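/- Let $(X,d)$ be a compact metric space and let $G$ be a locally compact abelian group acting continuously on $X$, $(t,x)\mapsto t\cdot x$, such that the action is minimal (every orbit is dense). Let $\pi_{max}:X\to X_{max}$ be the maximal equicontinuous factor of $(X,G)$, that is, the equicontinuous factor through which every other equicontinuous factor of $(X,G)$ factors, and call $\{(x,y)\in X\times X:\pi_{max}(x)=\pi_{max}(y)\}$ the equicontinuous structure relation. Let $$\Pr=\{(x,y)\in X\times X:\inf_{t\in G}d(t\cdot x,t\cdot y)=0\}$$ be the proximal relation, and let $$\mathcal Q=\bigcap_{\epsilon>0}\overline{\{(x,y)\in X\times X:\inf_{t\in G}d(t\cdot x,t\cdot y)<\epsilon\}}$$ be the regional proximal relation (the closures are taken in $X\times X$). Theorem. Suppose that the minimal rank $\inf\{\#\pi_{max}^{-1}(\xi):\xi\in X_{max}\}$ is finite and that $G$ is compactly generated, i.e. there is a compact neighbourhood $K$ of the identity of $G$ such that every element of $G$ is a finite sum of elements of $K$. Then $\Pr=\mathcal Q$ if and only if $\Pr$ is closed in $X\times X$. Likewise, $\Pr$ equals the equicontinuous structure relation if and only if $\Pr$ is closed in $X\times X$. -/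

import Mathlib

open Topology Filter Set
open scoped Pointwise

universe u v

namespace TopDyn

/-- The group `G` is compactly generated: there is a compact neighbourhood `K` of the identity
such that every element of `G` is a finite product of elements of `K`. -/
def CompactlyGeneratedGroup (G : Type v) [Group G] [TopologicalSpace G] : Prop :=
  ∃ K : Set G, IsCompact K ∧ K ∈ 𝓝 (1 : G) ∧ ⋃ n : ℕ, K ^ n = univ

section Metric

variable (G : Type v) (X : Type u) [Group G] [MetricSpace X] [MulAction G X]

/-- `Pr_ε`: the pairs `(x, y)` with `inf_{t ∈ G} d (t • x, t • y) < ε`. -/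
def epsProximalRel (ε : ℝ) : Set (X × X) :=
  {p | (⨅ t : G, dist (t • p.1) (t • p.2)) < ε}

/-- The proximal relation: the pairs `(x, y)` with `inf_{t ∈ G} d (t • x, t • y) = 0`. -/
def proximalRel : Set (X × X) :=
  {p | (⨅ t : G, dist (t • p.1) (t • p.2)) = 0}

/-- The regional proximal relation: the intersection over `ε > 0` of the closures of `Pr_ε`. -/
def regionalProximalRel : Set (X × X) :=
  ⋂ (ε : ℝ) (_ : 0 < ε), closure (epsProximalRel G X ε)

end Metric

/-- The action of `G` on the compact Hausdorff space `Y` is equicontinuous (at every point), with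
respect to the unique uniform structure that induces the topology of `Y`. -/
def IsEquicontinuousSystem (G : Type v) (Y : Type u) [Group G] [TopologicalSpace Y]
    [CompactSpace Y] [T2Space Y] [MulAction G Y] : Prop :=
  letI : UniformSpace Y := uniformSpaceOfCompactR1
  Equicontinuous (fun (t : G) (y : Y) => t • y)

/-- For a metric space, this is the usual `ε`-`δ` notion, whatever the metric. -/
theorem isEquicontinuousSystem_iff (G : Type v) (Y : Type u) [Group G] [MetricSpace Y]
    [CompactSpace Y] [MulAction G Y] :
    IsEquicontinuousSystem G Y ↔ ∀ y : Y, ∀ ε > 0, ∃ δ > 0, ∀ y' : Y, dist y' y < δ →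
      ∀ t : G, dist (t • y) (t • y') < ε := by
  have h : (uniformSpaceOfCompactR1 : UniformSpace Y) =
      PseudoMetricSpace.toUniformSpace :=
    unique_uniformity_of_compact rfl rfl
  unfold IsEquicontinuousSystem
  rw [h]
  exact forall_congr' fun y => Metric.equicontinuousAt_iff

/-- A factor map of `G`-systems: a continuous equivariant surjection. -/
structure IsFactorMap (G : Type v) {X : Type u} {Y : Type u} [TopologicalSpace X]
    [TopologicalSpace Y] [Group G] [MulAction G X] [MulAction G Y] (π : X → Y) : Prop where
  continuous : Continuous π
  surjective : Function.Surjective π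
  map_smul : ∀ (t : G) (x : X), π (t • x) = t • π x

/-- `(Y, G)` with factor map `π : X → Y` is a maximal equicontinuous factor of `(X, G)`: it is an
equicontinuous factor and any other equicontinuous factor of `(X, G)` factors through it. (For
compact metrizable `X`, a Hausdorff factor is automatically compact and metrizable.) -/
structure IsMaximalEquicontinuousFactor (G : Type v) {X : Type u} {Y : Type u}
    [TopologicalSpace X] [TopologicalSpace Y] [CompactSpace Y] [T2Space Y]
    [Group G] [MulAction G X] [MulAction G Y] [TopologicalSpace G] [ContinuousSMul G Y]
    (π : X → Y) : Prop where
  isFactorMap : IsFactorMap G π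
  equicontinuous : IsEquicontinuousSystem G Y
  exists_factor : ∀ (Z : Type u) [TopologicalSpace Z] [CompactSpace Z] [T2Space Z]
    [MulAction G Z] [ContinuousSMul G Z] (ρ : X → Z), IsFactorMap G ρ →
      IsEquicontinuousSystem G Z → ∃ h : Y → Z, IsFactorMap G h ∧ h ∘ π = ρ

section MaxFactor

variable (G : Type v) (X : Type u) [Group G] [TopologicalSpace G]
  [TopologicalSpace X] [MulAction G X]

/-- Two points are identified when no equicontinuous factor of `(X, G)` separates them. -/
def equicontinuousSetoid : Setoid X where
  r x y := ∀ (Z : Type u) [TopologicalSpace Z] [CompactSpace Z] [T2Space Z]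
    [MulAction G Z] [ContinuousSMul G Z] (ρ : X → Z), IsFactorMap G ρ →
      IsEquicontinuousSystem G Z → ρ x = ρ y
  iseqv :=
    { refl := fun _ _ _ _ _ _ _ _ _ _ => rfl
      symm := fun h Z _ _ _ _ _ ρ h1 h2 => (h Z ρ h1 h2).symm
      trans := fun h h' Z _ _ _ _ _ ρ h1 h2 => (h Z ρ h1 h2).trans (h' Z ρ h1 h2) }

/-- The maximal equicontinuous factor `X_max` of `(X, G)`, as a quotient space of `X`
(see `isMaximalEquicontinuousFactor_maxFactorMap`). -/
def MaxFactor : Type u := Quotient (equicontinuousSetoid G X)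

/-- The factor map `π_max : X → X_max`. -/
def maxFactorMap : X → MaxFactor G X := Quotient.mk (equicontinuousSetoid G X)

instance : TopologicalSpace (MaxFactor G X) :=
  inferInstanceAs (TopologicalSpace (Quotient (equicontinuousSetoid G X)))

instance [CompactSpace X] : CompactSpace (MaxFactor G X) :=
  inferInstanceAs (CompactSpace (Quotient (equicontinuousSetoid G X)))

theorem isQuotientMap_maxFactorMap : IsQuotientMap (maxFactorMap G X) := isQuotientMap_quot_mk

variable {G X} in
theorem exists_lift {Z : Type u} [TopologicalSpace Z] [CompactSpace Z] [T2Space Z]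
    [MulAction G Z] [ContinuousSMul G Z] {ρ : X → Z} (h1 : IsFactorMap G ρ)
    (h2 : IsEquicontinuousSystem G Z) :
    ∃ h : MaxFactor G X → Z, Continuous h ∧ ∀ x, h (maxFactorMap G X x) = ρ x :=
  ⟨Quotient.lift ρ fun _ _ hab => hab Z ρ h1 h2, h1.continuous.quotient_lift _, fun _ => rfl⟩

variable {G X} in
theorem exists_separating {a b : MaxFactor G X} (hab : a ≠ b) :
    ∃ (Z : Type u) (_ : TopologicalSpace Z) (_ : CompactSpace Z) (_ : T2Space Z)
      (_ : MulAction G Z) (_ : ContinuousSMul G Z) (ρ : X → Z) (h : MaxFactor G X → Z),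
      IsFactorMap G ρ ∧ IsEquicontinuousSystem G Z ∧ Continuous h ∧
      (∀ x, h (maxFactorMap G X x) = ρ x) ∧ h a ≠ h b := by
  obtain ⟨x, rfl⟩ := (isQuotientMap_maxFactorMap G X).surjective a
  obtain ⟨y, rfl⟩ := (isQuotientMap_maxFactorMap G X).surjective b
  by_contra hcon
  refine hab (Quotient.sound ?_)
  intro Z _ _ _ _ _ ρ h1 h2
  by_contra hne
  obtain ⟨h, hc, hh⟩ := exists_lift h1 h2
  exact hcon ⟨Z, _, ‹_›, ‹_›, _, ‹_›, ρ, h, h1, h2, hc, hh, by rwa [hh, hh]⟩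

instance : T2Space (MaxFactor G X) where
  t2 a b hab := by
    obtain ⟨Z, _, _, _, _, _, ρ, h, -, -, hc, -, hne⟩ := exists_separating hab
    exact separated_by_continuous hc hne

instance : MulAction G (MaxFactor G X) where
  smul t := Quotient.map (fun x => t • x) fun a b hab Z _ _ _ _ _ ρ h1 h2 => by
    rw [h1.map_smul, h1.map_smul, hab Z ρ h1 h2]
  one_smul a := by
    induction a using Quotient.inductionOn with
    | h x => exact congrArg (maxFactorMap G X) (one_smul G x)
  mul_smul s t a := by
    induction a using Quotient.inductionOn with
    | h x => exact congrArg (maxFactorMap G X) (mul_smul s t x)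

theorem maxFactorMap_smul (t : G) (x : X) :
    maxFactorMap G X (t • x) = t • maxFactorMap G X x := rfl

instance [CompactSpace X] [ContinuousSMul G X] : ContinuousSMul G (MaxFactor G X) where
  continuous_smul := by
    have hq := isQuotientMap_maxFactorMap G X
    have hp : IsProperMap (Prod.map (id : G → G) (maxFactorMap G X)) :=
      isProperMap_id.prodMap hq.continuous.isProperMap
    have hs : Function.Surjective (Prod.map (id : G → G) (maxFactorMap G X)) :=
      Function.surjective_id.prodMap hq.surjective
    rw [(hp.isClosedMap.isQuotientMap hp.continuous hs).continuous_iff]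
    exact hq.continuous.comp (continuous_smul (M := G) (X := X))

theorem isEquicontinuousSystem_maxFactor [CompactSpace X] :
    IsEquicontinuousSystem G (MaxFactor G X) := by
  unfold IsEquicontinuousSystem
  let _ : UniformSpace (MaxFactor G X) := uniformSpaceOfCompactR1
  intro z V hV
  obtain ⟨W, ⟨hW, hWo⟩, hWV⟩ := uniformity_hasBasis_open.mem_iff.1 hV
  have key : ∀ᶠ z' in 𝓝 z, ∀ t : G, (t • z, t • z') ∉ Wᶜ := by
    refine hWo.isClosed_compl.isCompact.induction_on
      (p := fun s => ∀ᶠ z' in 𝓝 z, ∀ t : G, (t • z, t • z') ∉ s) (by simp) ?_ ?_ ?_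
    · intro s s' hss hs'
      filter_upwards [hs'] with z' h t ht using h t (hss ht)
    · intro s s' hs hs'
      filter_upwards [hs, hs'] with z' h h' t ht using ht.elim (h t) (h' t)
    · rintro ⟨a, b⟩ hab
      have hne : a ≠ b := fun h => hab (h ▸ refl_mem_uniformity hW)
      obtain ⟨Z, _, _, _, _, _, ρ, h, h1, h2, hc, hh, hne'⟩ := exists_separating hne
      let _ : UniformSpace Z := uniformSpaceOfCompactR1
      have hsm : ∀ (t : G) (w : MaxFactor G X), h (t • w) = t • h w := by
        intro t w
        obtain ⟨x, rfl⟩ := (isQuotientMap_maxFactorMap G X).surjective w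
        rw [← maxFactorMap_smul, hh, hh, h1.map_smul]
      have hU : {((h a, h b) : Z × Z)}ᶜ ∈ uniformity Z := by
        rw [← nhdsSet_diagonal_eq_uniformity]
        refine (isOpen_compl_singleton.mem_nhdsSet).2 ?_
        rintro ⟨p, q⟩ (hpq : p = q) (hpq' : (p, q) = (h a, h b))
        exact hne' (by rw [← (Prod.mk.inj hpq').1, ← (Prod.mk.inj hpq').2, hpq])
      obtain ⟨T, ⟨hT, hTc⟩, hTU⟩ := uniformity_hasBasis_closed.mem_iff.1 hU
      have heq : ∀ᶠ w in 𝓝 (h z), ∀ t : G, (t • h z, t • w) ∈ T := h2 (h z) T hT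
      refine ⟨(Prod.map h h) ⁻¹' Tᶜ, mem_nhdsWithin_of_mem_nhds
        ((hTc.isOpen_compl.preimage (hc.prodMap hc)).mem_nhds fun hin => hTU hin rfl), ?_⟩
      filter_upwards [hc.continuousAt.eventually heq] with z' hz' t ht
      refine ht ?_
      change (h (t • z), h (t • z')) ∈ T
      rw [hsm, hsm]
      exact hz' t
  filter_upwards [key] with z' hz' t
  exact hWV (not_not.1 (hz' t))

/-- The quotient `X_max` with `π_max` is indeed the maximal equicontinuous factor. -/
theorem isMaximalEquicontinuousFactor_maxFactorMap [CompactSpace X] [ContinuousSMul G X] :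
    IsMaximalEquicontinuousFactor G (maxFactorMap G X) where
  isFactorMap :=
    ⟨(isQuotientMap_maxFactorMap G X).continuous, (isQuotientMap_maxFactorMap G X).surjective,
      maxFactorMap_smul G X⟩
  equicontinuous := isEquicontinuousSystem_maxFactor G X
  exists_factor Z _ _ _ _ _ ρ h1 h2 := by
    obtain ⟨h, hc, hh⟩ := exists_lift h1 h2
    refine ⟨h, ⟨hc, fun z => ?_, fun t w => ?_⟩, funext hh⟩
    · obtain ⟨x, rfl⟩ := h1.surjective z
      exact ⟨_, hh x⟩
    · obtain ⟨x, rfl⟩ := (isQuotientMap_maxFactorMap G X).surjective w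
      rw [← maxFactorMap_smul, hh, hh, h1.map_smul]

/-- The equicontinuous structure relation: the pairs of points with the same image in `X_max`. -/
def equicontinuousStructureRel : Set (X × X) :=
  {p | maxFactorMap G X p.1 = maxFactorMap G X p.2}

/-- The minimal rank of `(X, G)`: the infimum of the cardinalities of the fibres of `π_max`. -/
noncomputable def minimalRank : ℕ∞ :=
  ⨅ z : MaxFactor G X, (maxFactorMap G X ⁻¹' {z}).encard

end MaxFactor

end TopDyn

/-!
Write `Pr`, `Q`, `E` for the proximal, regional proximal and equicontinuous structure relations.
Equicontinuity of `X_max` gives `Pr ⊆ Q ⊆ E`, and `Q` and `E` are closed. So both equivalences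
follow once it is known that `E ⊆ Pr` whenever `Pr` is closed
(`equicontinuousStructureRel_subset_proximalRel`).

Let `Pr` be closed. Then it is an equivalence relation (`proximalRel_trans`), and `X / Pr` is a
compact Hausdorff extension of `X_max`. It suffices that `X / Pr` is equicontinuous, since then
`π_max` separates the classes of `Pr`.

The finite minimal rank enters as follows. It bounds the number of pairwise non-proximal points in
any fibre of `π_max`. The orbit closure of a tuple attaining the maximal number consists of such
tuples, is compact, and meets every fibre. Hence every point of `X / Pr` lies in a fibre that is
listed by a tuple from one compact set of tuples with distinct entries, and so `E \ Pr` is closed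
(`isClosed_equicontinuousStructureRel_diff_proximalRel`): distinct points in a common fibre of
`X / Pr → X_max` stay away from the diagonal.

Compact generation enters in the passage from such uniformly discrete fibres to equicontinuity
(`IsEquicontinuousSystem.of_isClosed_offDiag`). Two points of `X / Pr` whose images in `X_max` are
close are either very close or far apart. A generator moves very close points to points that are
not far apart, and it keeps the images close, so it moves them to very close points. By induction
this holds for all elements of the group.
-/

namespace TopDyn

/-! ### Closed equivalence relations on compact spaces -/

section Quotient

variable {X : Type u} [TopologicalSpace X] [CompactSpace X] [T2Space X] (s : Setoid X)

theorem isClosedMap_quotientMk_of_isClosed (hs : IsClosed {p : X × X | s p.1 p.2}) :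
    IsClosedMap (Quotient.mk s) := by
  intro C hC
  rw [← (isQuotientMap_quotient_mk' (s := s)).isClosed_preimage]
  have : Quotient.mk' ⁻¹' (Quotient.mk s '' C) =
      Prod.snd '' ({p : X × X | s p.1 p.2} ∩ Prod.fst ⁻¹' C) := by
    ext y
    constructor
    · rintro ⟨x, hx, hxy⟩
      exact ⟨(x, y), ⟨Quotient.exact hxy, hx⟩, rfl⟩
    · rintro ⟨⟨x, _⟩, ⟨hxy, hx⟩, rfl⟩
      exact ⟨x, hx, Quotient.sound hxy⟩
  rw [this]
  exact ((hs.inter (hC.preimage continuous_fst)).isCompact.image continuous_snd).isClosed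

theorem t2Space_quotient_of_isClosed (hs : IsClosed {p : X × X | s p.1 p.2}) :
    T2Space (Quotient s) where
  t2 a b hab := by
    have hcont : Continuous (Quotient.mk s) := continuous_quot_mk
    have hclosed := isClosedMap_quotientMk_of_isClosed s hs
    have hfib (c : Quotient s) : IsClosed (Quotient.mk s ⁻¹' {c}) := by
      obtain ⟨x, rfl⟩ := Quotient.exists_rep c
      have := (hclosed _ (isClosed_singleton (x := x))).preimage hcont
      rwa [image_singleton] at this
    obtain ⟨U, V, hU, hV, haU, hbV, hUV⟩ := normal_separation (hfib a) (hfib b)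
      (disjoint_left.2 fun x hxa hxb => hab (hxa.symm.trans hxb))
    refine ⟨kernImage (Quotient.mk s) U, kernImage (Quotient.mk s) V,
      isClosedMap_iff_kernImage.1 hclosed hU, isClosedMap_iff_kernImage.1 hclosed hV,
      fun x hx => haU hx, fun x hx => hbV hx, disjoint_left.2 fun c hcU hcV => ?_⟩
    obtain ⟨x, rfl⟩ := Quotient.exists_rep c
    exact disjoint_left.1 hUV (hcU rfl) (hcV rfl)

/-- The action induced on the quotient by an invariant equivalence relation. -/
abbrev quotientMulAction {G : Type v} [Group G] [MulAction G X]
    (hinv : ∀ (t : G) (x y : X), s x y → s (t • x) (t • y)) : MulAction G (Quotient s) where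
  smul t := Quotient.map (fun x => t • x) fun x y h => hinv t x y h
  one_smul a := by
    induction a using Quotient.inductionOn with
    | h x => exact congrArg (Quotient.mk s) (one_smul G x)
  mul_smul t t' a := by
    induction a using Quotient.inductionOn with
    | h x => exact congrArg (Quotient.mk s) (mul_smul t t' x)

end Quotient

theorem IsFactorMap.continuousSMul {G : Type v} {X Y : Type u} [Group G] [TopologicalSpace G]
    [TopologicalSpace X] [CompactSpace X] [TopologicalSpace Y] [T2Space Y] [MulAction G X]
    [ContinuousSMul G X] [MulAction G Y] {π : X → Y} (h : IsFactorMap G π) :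
    ContinuousSMul G Y where
  continuous_smul := by
    have hp : IsProperMap (Prod.map (id : G → G) π) :=
      isProperMap_id.prodMap h.continuous.isProperMap
    have hs : Function.Surjective (Prod.map (id : G → G) π) :=
      Function.surjective_id.prodMap h.surjective
    rw [(hp.isClosedMap.isQuotientMap hp.continuous hs).continuous_iff]
    have : (fun p : G × Y => p.1 • p.2) ∘ Prod.map (id : G → G) π =
        π ∘ fun p : G × X => p.1 • p.2 := funext fun p => (h.map_smul p.1 p.2).symm
    rw [this]
    exact h.continuous.comp continuous_smul

/-! ### Equicontinuity and extensions with uniformly discrete fibres -/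

section Equicontinuous

variable {G : Type v} [Group G]

/-- Equicontinuity at every point is, by compactness, uniform, and the entourages of a compact
Hausdorff space are the neighbourhoods of the diagonal. -/
theorem isEquicontinuousSystem_iff_nhdsSet {Y : Type u} [TopologicalSpace Y] [CompactSpace Y]
    [T2Space Y] [MulAction G Y] :
    IsEquicontinuousSystem G Y ↔ ∀ V ∈ 𝓝ˢ (diagonal Y),
      {p : Y × Y | ∀ t : G, (t • p.1, t • p.2) ∈ V} ∈ 𝓝ˢ (diagonal Y) := by
  let _ : UniformSpace Y := uniformSpaceOfCompactR1
  rw [nhdsSet_diagonal_eq_uniformity]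
  exact ⟨fun h => CompactSpace.uniformEquicontinuous_of_equicontinuous h,
    fun h => UniformEquicontinuous.equicontinuous h⟩

/-- If distinct points in a common fibre of an extension of an equicontinuous system stay away
from the diagonal, and the group is compactly generated, then the extension is equicontinuous.

Near the diagonal, two points whose images are close must be very close: intermediate distances
are excluded by compactness. As the closeness of the images is invariant, a generator cannot take
a very close pair out of this range, and hence no group element can. -/
theorem IsEquicontinuousSystem.of_isClosed_offDiag [TopologicalSpace G]
    (hG : CompactlyGeneratedGroup G) {Y Z : Type u} [TopologicalSpace Y] [CompactSpace Y]
    [T2Space Y] [TopologicalSpace Z] [CompactSpace Z] [T2Space Z] [MulAction G Y]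
    [ContinuousSMul G Y] [MulAction G Z] {q : Y → Z} (hq : Continuous q)
    (hequiv : ∀ (t : G) (y : Y), q (t • y) = t • q y) (hZ : IsEquicontinuousSystem G Z)
    (hsep : IsClosed {p : Y × Y | q p.1 = q p.2 ∧ p.1 ≠ p.2}) :
    IsEquicontinuousSystem G Y := by
  obtain ⟨K, hK, -, hKgen⟩ := hG
  rw [isEquicontinuousSystem_iff_nhdsSet] at hZ ⊢
  intro V₀ hV₀
  obtain ⟨W, hW, hWc, hWsep⟩ := exists_mem_nhdsSet_isClosed_subset
    (hsep.isOpen_compl.mem_nhdsSet.2 fun p hp hp' => hp'.2 hp) isClosed_diagonal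
  have hKW : {p : Y × Y | ∀ k ∈ K, (k • p.1, k • p.2) ∈ W} ∈ 𝓝ˢ (diagonal Y) := by
    rw [mem_nhdsSet_iff_forall]
    intro p hp
    refine hK.eventually_forall_of_forall_eventually fun k _ => ?_
    have hc : Continuous fun z : (Y × Y) × G => (z.2 • z.1.1, z.2 • z.1.2) := by fun_prop
    exact hc.continuousAt.eventually
      (mem_nhdsSet_iff_forall.1 hW (k • p.1, k • p.2) (congrArg (k • ·) hp))
  obtain ⟨V, hVo, hdV, hV⟩ :=
    mem_nhdsSet_iff_exists.1 (inter_mem (inter_mem hV₀ hW) hKW)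
  have hqq : Continuous (Prod.map q q) := hq.prodMap hq
  -- the pairs at intermediate distance have images off the diagonal
  have hL : (Prod.map q q '' (W \ V))ᶜ ∈ 𝓝ˢ (diagonal Z) := by
    refine (((hWc.sdiff hVo).isCompact.image hqq).isClosed.isOpen_compl).mem_nhdsSet.2 ?_
    rintro p hp ⟨r, ⟨hrW, hrV⟩, rfl⟩
    exact hWsep hrW ⟨hp, fun h => hrV (hdV h)⟩
  have hU := hZ _ hL
  set U := {p : Z × Z | ∀ t : G, (t • p.1, t • p.2) ∈ (Prod.map q q '' (W \ V))ᶜ}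
  have hpre : Prod.map q q ⁻¹' U ∈ 𝓝ˢ (diagonal Y) :=
    hqq.tendsto_nhdsSet (fun p hp => congrArg q hp) hU
  filter_upwards [hVo.mem_nhdsSet.2 hdV, hpre] with p hpV hpU
  have hstep : ∀ n : ℕ, ∀ t ∈ K ^ n, (t • p.1, t • p.2) ∈ V := by
    intro n
    induction n with
    | zero =>
      intro t ht
      rw [pow_zero, Set.mem_one] at ht
      simpa [ht] using hpV
    | succ n ih =>
      intro t ht
      rw [pow_succ', Set.mem_mul] at ht
      obtain ⟨k, hk, t', ht', rfl⟩ := ht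
      by_contra hcon
      refine hpU (k * t') ⟨((k * t') • p.1, (k * t') • p.2), ⟨?_, hcon⟩, ?_⟩
      · simpa only [mul_smul] using (hV (ih t' ht')).2 k hk
      · simp [hequiv]
  intro t
  obtain ⟨n, hn⟩ := mem_iUnion.1 (hKgen ▸ mem_univ t : t ∈ ⋃ n : ℕ, K ^ n)
  exact (hV (hstep n t hn)).1.1

end Equicontinuous

/-! ### The three relations -/

section Relations

variable {G : Type v} {X : Type u} [Group G] [MetricSpace X] [MulAction G X]

theorem mem_epsProximalRel_iff {ε : ℝ} {p : X × X} :
    p ∈ epsProximalRel G X ε ↔ ∃ t : G, dist (t • p.1) (t • p.2) < ε :=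
  ciInf_lt_iff ⟨0, forall_mem_range.2 fun _ => dist_nonneg⟩

theorem mem_proximalRel_iff {p : X × X} :
    p ∈ proximalRel G X ↔ ∀ ε > 0, ∃ t : G, dist (t • p.1) (t • p.2) < ε := by
  have h0 : 0 ≤ ⨅ t : G, dist (t • p.1) (t • p.2) := Real.iInf_nonneg fun _ => dist_nonneg
  simp only [← mem_epsProximalRel_iff]
  exact ⟨fun h ε hε => (show _ = _ from h).trans_lt hε,
    fun h => le_antisymm (le_of_forall_pos_lt_add fun ε hε =>
      (h ε hε).trans_eq (zero_add ε).symm) h0⟩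

theorem proximalRel_refl (x : X) : (x, x) ∈ proximalRel G X :=
  mem_proximalRel_iff.2 fun ε hε => ⟨1, by simpa using hε⟩

theorem proximalRel_symm {x y : X} (h : (x, y) ∈ proximalRel G X) :
    (y, x) ∈ proximalRel G X := by
  rw [mem_proximalRel_iff] at h ⊢
  simpa only [dist_comm] using h

theorem proximalRel_smul (t : G) {x y : X} (h : (x, y) ∈ proximalRel G X) :
    (t • x, t • y) ∈ proximalRel G X := by
  rw [mem_proximalRel_iff] at h ⊢
  intro ε hε
  obtain ⟨r, hr⟩ := h ε hε
  exact ⟨r * t⁻¹, by simpa [mul_smul] using hr⟩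

theorem proximalRel_subset_regionalProximalRel :
    proximalRel G X ⊆ regionalProximalRel G X := fun _ hp =>
  mem_iInter₂.2 fun ε hε =>
    subset_closure (mem_epsProximalRel_iff.2 (mem_proximalRel_iff.1 hp ε hε))

theorem isClosed_regionalProximalRel : IsClosed (regionalProximalRel G X) :=
  isClosed_iInter fun _ => isClosed_iInter fun _ => isClosed_closure

variable [TopologicalSpace G]

theorem isClosed_equicontinuousStructureRel : IsClosed (equicontinuousStructureRel G X) :=
  isClosed_eq ((isQuotientMap_maxFactorMap G X).continuous.comp continuous_fst)
    ((isQuotientMap_maxFactorMap G X).continuous.comp continuous_snd)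

theorem regionalProximalRel_subset_equicontinuousStructureRel [CompactSpace X] :
    regionalProximalRel G X ⊆ equicontinuousStructureRel G X := by
  intro p hp
  by_contra hne
  have hπ := (isQuotientMap_maxFactorMap G X).continuous
  have hππ := hπ.prodMap hπ
  set π := maxFactorMap G X with hπdef
  -- a closed neighbourhood of the diagonal that misses the image of `p`
  obtain ⟨V, hV, hVc, hpV⟩ := exists_mem_nhdsSet_isClosed_subset
    (isOpen_compl_singleton.mem_nhdsSet.2 
      (show diagonal (MaxFactor G X) ⊆ {Prod.map π π p}ᶜ by rintro r hr rfl; exact hne hr))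
    isClosed_diagonal
  have hU := isEquicontinuousSystem_iff_nhdsSet.1 (isEquicontinuousSystem_maxFactor G X) V hV
  have hpre : Prod.map π π ⁻¹' {r | ∀ t : G, (t • r.1, t • r.2) ∈ V} ∈ 𝓝ˢ (diagonal X) :=
    hππ.tendsto_nhdsSet (fun r hr => congrArg π hr) hU
  rw [nhdsSet_diagonal_eq_uniformity] at hpre
  obtain ⟨ε, hε, hball⟩ := Metric.mem_uniformity_dist.1 hpre
  have hsub : epsProximalRel G X ε ⊆ Prod.map π π ⁻¹' V := by
    intro r hr
    obtain ⟨t, ht⟩ := mem_epsProximalRel_iff.1 hr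
    have := hball ht t⁻¹
    rwa [mem_preimage, Prod.map_apply', hπdef, ← inv_smul_smul t r.1, ← inv_smul_smul t r.2]
  exact hpV (closure_minimal hsub (hVc.preimage hππ) (mem_iInter₂.1 hp ε hε)) rfl

variable [ContinuousSMul G X]

/-- A pair is proximal as soon as some pair in its orbit closure is. -/
theorem mem_proximalRel_of_mem_closure_orbit {p q : X × X}
    (hq : q ∈ closure (MulAction.orbit G p)) (h : q ∈ proximalRel G X) :
    p ∈ proximalRel G X := by
  rw [mem_proximalRel_iff] at h ⊢
  intro ε hε
  obtain ⟨s, hs⟩ := h ε hε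
  have hopen : IsOpen {r : X × X | dist (s • r.1) (s • r.2) < ε} :=
    isOpen_lt (by fun_prop) continuous_const
  obtain ⟨_, hr, t, rfl⟩ := mem_closure_iff.1 hq _ hopen hs
  exact ⟨s * t, by simpa [mul_smul] using hr⟩

variable [CompactSpace X]

/-- A closed proximal relation is transitive: if `t_n • (x, y, z)` converges to `(a, a, c)`, then
`(a, c)` is a limit of the proximal pairs `t_n • (y, z)`, so it is proximal, and it lies in the
orbit closure of `(x, z)`. -/
theorem proximalRel_trans (hP : IsClosed (proximalRel G X)) {x y z : X}
    (hxy : (x, y) ∈ proximalRel G X) (hyz : (y, z) ∈ proximalRel G X) :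
    (x, z) ∈ proximalRel G X := by
  have h (n : ℕ) : ∃ t : G, dist (t • x) (t • y) < 1 / ((n : ℝ) + 1) :=
    mem_proximalRel_iff.1 hxy _ Nat.one_div_pos_of_nat
  choose t ht using h
  obtain ⟨⟨a, b, c⟩, -, φ, hφ, hlim⟩ := isCompact_univ.tendsto_subseq
    (x := fun n => (t n • x, t n • y, t n • z)) fun n => mem_univ _
  rw [nhds_prod_eq, nhds_prod_eq, tendsto_prod_iff', tendsto_prod_iff'] at hlim
  obtain ⟨ha, hb, hc⟩ := hlim
  have hab : a = b := by
    refine dist_eq_zero.1 (tendsto_nhds_unique (ha.dist hb) ?_)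
    refine squeeze_zero (fun _ => dist_nonneg) (fun n => (ht (φ n)).le) ?_
    exact tendsto_one_div_add_atTop_nhds_zero_nat.comp hφ.tendsto_atTop
  subst hab
  have hac : (a, c) ∈ proximalRel G X :=
    hP.mem_of_tendsto (hb.prodMk_nhds hc) (Eventually.of_forall fun n => proximalRel_smul _ hyz)
  exact mem_proximalRel_of_mem_closure_orbit
    (mem_closure_of_tendsto (ha.prodMk_nhds hc) (Eventually.of_forall fun n => ⟨t (φ n), rfl⟩)) hac

end Relations

/-! ### Tuples of pairwise distal points in a common fibre -/

theorem exists_mem_closure_orbit_apply_eq {G : Type v} {X : Type u} [Group G]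
    [MetricSpace X] [CompactSpace X] [MulAction G X] [MulAction.IsMinimal G X] {n : ℕ}
    (z : Fin n → X) (i : Fin n) (x : X) : ∃ w ∈ closure (MulAction.orbit G z), w i = x := by
  have hcl : IsClosed ((fun w : Fin n → X => w i) '' closure (MulAction.orbit G z)) :=
    (isClosed_closure.isCompact.image (continuous_apply i)).isClosed
  have hdense := MulAction.dense_orbit G (z i)
  refine closure_minimal ?_ hcl (hdense x)
  rintro _ ⟨t, rfl⟩
  exact ⟨t • z, subset_closure ⟨t, rfl⟩, rfl⟩

section Spread

variable {G : Type v} {X : Type u} [Group G] [TopologicalSpace G] [MetricSpace X]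
  [MulAction G X] [ContinuousSMul G X]

variable (G) in
/-- The points of the tuple lie in a common fibre of `π_max` and are pairwise not proximal. -/
def IsSpread {n : ℕ} (z : Fin n → X) : Prop :=
  Pairwise fun i j => (z i, z j) ∈ equicontinuousStructureRel G X \ proximalRel G X

/-- The orbit closure of a non-proximal pair contains no proximal pair, so limits keep the points
of the tuple pairwise non-proximal. -/
theorem IsSpread.of_mem_closure_orbit {n : ℕ} {z w : Fin n → X} (hz : IsSpread G z)
    (hw : w ∈ closure (MulAction.orbit G z)) : IsSpread G w := by
  intro i j hij
  have hmem : (w i, w j) ∈ closure (MulAction.orbit G (z i, z j)) := by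
    refine map_mem_closure (f := fun u : Fin n → X => (u i, u j)) (by fun_prop) hw ?_
    rintro _ ⟨t, rfl⟩
    exact ⟨t, rfl⟩
  refine ⟨closure_minimal ?_ isClosed_equicontinuousStructureRel hmem, fun h =>
    (hz hij).2 (mem_proximalRel_of_mem_closure_orbit hmem h)⟩
  rintro _ ⟨t, rfl⟩
  exact congrArg (t • ·) (hz hij).1

variable [CompactSpace X]

/-- A tuple of pairwise distal points can be moved, in the limit, into a smallest fibre, and there
its points stay distinct. -/
theorem IsSpread.natCast_le_minimalRank [MulAction.IsMinimal G X] {n : ℕ} {z : Fin n → X}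
    (hz : IsSpread G z) : (n : ℕ∞) ≤ minimalRank G X := by
  refine le_iInf fun ξ => ?_
  obtain ⟨x, rfl⟩ := (isQuotientMap_maxFactorMap G X).surjective ξ
  rcases n with _ | n
  · simp
  obtain ⟨w, hw, hwx⟩ := exists_mem_closure_orbit_apply_eq (G := G) z 0 x
  have hws := hz.of_mem_closure_orbit hw
  have hinj : Function.Injective w := by
    intro i j hij
    by_contra hne
    exact (hws hne).2 (hij ▸ proximalRel_refl _)
  have hsub : range w ⊆ maxFactorMap G X ⁻¹' {maxFactorMap G X x} := by
    rintro _ ⟨i, rfl⟩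
    rcases eq_or_ne i 0 with rfl | hi
    · exact congrArg _ hwx
    · exact (hws hi).1.trans (congrArg _ hwx)
  calc ((n + 1 : ℕ) : ℕ∞) = (range w).encard := by
        rw [← image_univ, hinj.encard_image, encard_univ]; simp
    _ ≤ _ := encard_le_encard hsub

theorem exists_maximal_isSpread [MulAction.IsMinimal G X] [Nonempty X]
    (hrank : minimalRank G X ≠ ⊤) :
    ∃ n : ℕ, (∃ z : Fin (n + 1) → X, IsSpread G z) ∧ ¬ ∃ z : Fin (n + 2) → X, IsSpread G z := by
  obtain ⟨r, hr⟩ := ENat.ne_top_iff_exists.1 hrank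
  by_contra! hcon
  have hall (n : ℕ) : ∃ z : Fin (n + 1) → X, IsSpread G z := by
    induction n with
    | zero =>
      exact ⟨fun _ => Classical.arbitrary X, fun i j hij =>
        (hij (Fin.subsingleton_one.elim i j)).elim⟩
    | succ n ih => exact hcon n ih
  obtain ⟨z, hz⟩ := hall r
  have := hz.natCast_le_minimalRank
  rw [← hr, Nat.cast_le] at this
  omega

/-- Take a tuple of pairwise distal points in a common fibre that is as long as possible. The
tuples in its orbit closure `C` have the same property, and every point `x` is the first entry of
some `w ∈ C`. So the distal pairs `(x, y)` in a fibre are those for which `y` is proximal to some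
later entry of such a `w`, and by compactness of `C` they form a closed set. -/
theorem isClosed_equicontinuousStructureRel_diff_proximalRel [MulAction.IsMinimal G X]
    (hrank : minimalRank G X ≠ ⊤) (hP : IsClosed (proximalRel G X)) :
    IsClosed (equicontinuousStructureRel G X \ proximalRel G X) := by
  rcases isEmpty_or_nonempty X with hX | hX
  · exact isClosed_discrete _
  obtain ⟨n, ⟨z, hz⟩, hmax⟩ := exists_maximal_isSpread (G := G) (X := X) hrank
  set C := closure (MulAction.orbit G z)
  have hPE : proximalRel G X ⊆ equicontinuousStructureRel G X :=
    proximalRel_subset_regionalProximalRel.trans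
      regionalProximalRel_subset_equicontinuousStructureRel
  have hEq : equicontinuousStructureRel G X \ proximalRel G X =
      ⋃ j : Fin n, (fun r : (Fin (n + 1) → X) × X => (r.1 0, r.2)) ''
        {r | r.1 ∈ C ∧ (r.1 j.succ, r.2) ∈ proximalRel G X} := by
    ext ⟨x, y⟩
    simp only [mem_iUnion]
    constructor
    · rintro ⟨hE, hnP⟩
      obtain ⟨w, hw, rfl⟩ := exists_mem_closure_orbit_apply_eq (G := G) z 0 x
      have hws := hz.of_mem_closure_orbit hw
      by_contra! hcon
      have hy : ∀ i, (w i, y) ∈ equicontinuousStructureRel G X \ proximalRel G X := by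
        intro i
        refine Fin.cases ⟨hE, hnP⟩ (fun j => ⟨?_, fun h => hcon j ⟨(w, y), ⟨hw, h⟩, rfl⟩⟩) i
        exact (hws (Fin.succ_ne_zero j)).1.trans hE
      refine hmax ⟨Fin.cons y w, fun i j => ?_⟩
      refine Fin.cases ?_ (fun i => ?_) i <;> refine Fin.cases ?_ (fun j => ?_) j
      · exact fun h => (h rfl).elim
      · exact fun _ => ⟨(hy j).1.symm, fun h => (hy j).2 (proximalRel_symm h)⟩
      · exact fun _ => hy i
      · exact fun h => hws fun hij => h (congrArg Fin.succ hij)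
    · rintro ⟨j, ⟨w, y⟩, ⟨hw, hwy⟩, h⟩
      obtain ⟨rfl, rfl⟩ := Prod.mk.inj h
      have hws := hz.of_mem_closure_orbit hw (Fin.succ_ne_zero j).symm
      exact ⟨hws.1.trans (hPE hwy), fun h => hws.2 (proximalRel_trans hP h (proximalRel_symm hwy))⟩
  rw [hEq]
  refine isClosed_iUnion_of_finite fun j => (IsCompact.image ?_ (by fun_prop)).isClosed
  refine (IsClosed.inter (isClosed_closure.preimage continuous_fst)
    (hP.preimage (f := fun r : (Fin (n + 1) → X) × X => (r.1 j.succ, r.2))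
      (by fun_prop))).isCompact

end Spread

/-! ### The quotient by a closed proximal relation -/

section ProximalQuotient

variable {G : Type v} {X : Type u} [Group G] [TopologicalSpace G] [MetricSpace X]
  [CompactSpace X] [MulAction G X] [ContinuousSMul G X]

/-- The proximal relation, when closed, as an equivalence relation. -/
abbrev proximalSetoid (hP : IsClosed (proximalRel G X)) : Setoid X where
  r x y := (x, y) ∈ proximalRel G X
  iseqv := ⟨proximalRel_refl, proximalRel_symm, proximalRel_trans hP⟩

/-- The quotient by a closed proximal relation is an equicontinuous system, so `π_max` separates
any two points that are not proximal. -/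
theorem equicontinuousStructureRel_subset_proximalRel [MulAction.IsMinimal G X]
    (hrank : minimalRank G X ≠ ⊤) (hG : CompactlyGeneratedGroup G)
    (hP : IsClosed (proximalRel G X)) :
    equicontinuousStructureRel G X ⊆ proximalRel G X := by
  let s := proximalSetoid hP
  have hPE : proximalRel G X ⊆ equicontinuousStructureRel G X :=
    proximalRel_subset_regionalProximalRel.trans
      regionalProximalRel_subset_equicontinuousStructureRel
  let _ : MulAction G (Quotient s) := quotientMulAction s fun t _ _ h => proximalRel_smul t h
  have hT2 : T2Space (Quotient s) := t2Space_quotient_of_isClosed s hP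
  have hρ : IsFactorMap G (Quotient.mk s) :=
    ⟨continuous_quot_mk, Quotient.mk_surjective, fun _ _ => rfl⟩
  have hsmul : ContinuousSMul G (Quotient s) := hρ.continuousSMul
  let q : Quotient s → MaxFactor G X := Quotient.lift (maxFactorMap G X) fun _ _ h => hPE h
  have hqc : Continuous q := (isQuotientMap_maxFactorMap G X).continuous.quotient_lift _
  have hqG (t : G) (a : Quotient s) : q (t • a) = t • q a := by
    obtain ⟨x, rfl⟩ := Quotient.exists_rep a
    exact maxFactorMap_smul G X t x
  have hsep : IsClosed {p : Quotient s × Quotient s | q p.1 = q p.2 ∧ p.1 ≠ p.2} := by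
    have himg : {p : Quotient s × Quotient s | q p.1 = q p.2 ∧ p.1 ≠ p.2} =
        Prod.map (Quotient.mk s) (Quotient.mk s) ''
          (equicontinuousStructureRel G X \ proximalRel G X) := by
      ext ⟨a, b⟩
      constructor
      · obtain ⟨x, rfl⟩ := Quotient.exists_rep a
        obtain ⟨y, rfl⟩ := Quotient.exists_rep b
        exact fun h => ⟨(x, y), ⟨h.1, fun hxy => h.2 (Quotient.sound hxy)⟩, rfl⟩
      · rintro ⟨⟨x, y⟩, ⟨hE, hnP⟩, h⟩
        obtain ⟨rfl, rfl⟩ := Prod.mk.inj h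
        exact ⟨hE, fun hxy => hnP (Quotient.exact hxy)⟩
    rw [himg]
    exact ((isClosed_equicontinuousStructureRel_diff_proximalRel hrank hP).isCompact.image
      (hρ.continuous.prodMap hρ.continuous)).isClosed
  have hequi : IsEquicontinuousSystem G (Quotient s) :=
    .of_isClosed_offDiag hG hqc hqG (isEquicontinuousSystem_maxFactor G X) hsep
  intro p hp
  exact Quotient.exact (Quotient.exact hp (Quotient s) (Quotient.mk s) hρ hequi)

end ProximalQuotient

end TopDyn

theorem mainTheorem2 {G : Type v} {X : Type u}
    [CommGroup G] [TopologicalSpace G] [IsTopologicalGroup G] [LocallyCompactSpace G]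
    [MetricSpace X] [CompactSpace X] [MulAction G X] [ContinuousSMul G X]
    [MulAction.IsMinimal G X]
    (hrank : TopDyn.minimalRank G X ≠ ⊤)
    (hG : TopDyn.CompactlyGeneratedGroup G) :
    (TopDyn.proximalRel G X = TopDyn.regionalProximalRel G X ↔
        IsClosed (TopDyn.proximalRel G X)) ∧
      (TopDyn.proximalRel G X = TopDyn.equicontinuousStructureRel G X ↔
        IsClosed (TopDyn.proximalRel G X)) := by
  have hPQ := TopDyn.proximalRel_subset_regionalProximalRel (G := G) (X := X)
  have hQE := TopDyn.regionalProximalRel_subset_equicontinuousStructureRel (G := G) (X := X)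
  have hEP := TopDyn.equicontinuousStructureRel_subset_proximalRel hrank hG
  exact ⟨⟨fun h => h ▸ TopDyn.isClosed_regionalProximalRel,
      fun hP => hPQ.antisymm (hQE.trans (hEP hP))⟩,
    ⟨fun h => h ▸ TopDyn.isClosed_equicontinuousStructureRel,
      fun hP => (hPQ.trans hQE).antisymm (hEP hP)⟩⟩
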